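/- Let $N\in\mathbb N$, $a\ge 0$, $b>0$, and put $\alpha:=a+b-1>-1$, $\beta:=b-1>-1$. Let $A:=\{x\in\mathbb R^N : -1\le x_1\le\dots\le x_N\le 1\}$, and for $\kappa>0$ let $X_\kappa$ be an $\mathbb R^N$-valued random variable whose distribution $\mu_\kappa$ is the probability measure on $A$ with Lebesgue density $$c_\kappa\prod_{1\le i<j\le N}(x_j-x_i)^{\kappa}\prod_{i=1}^N(1-x_i)^{\frac{\kappa(a+b)}{2}-\frac12}(1+x_i)^{\frac{\kappa b}{2}-\frac12},$$ where $c_\kappa>0$ is the normalization constant (the different $X_\kappa$ may live on different probability spaces). Let $z=(z_1,\dots,z_N)$ be the vector of the ordered zeros $z_1\le\dots\le z_N$ of the Jacobi polynomial $$P_N^{(\alpha,\beta)}(x)=\frac1{N!}\sum_{k=0}^N\binom Nk (N+\alpha+\beta+1)_k\,(\alpha+k+1)_{N-k}\Bigl(\frac{x-1}{2}\Bigr)^k ,\qquad (c)_k:=c(c+1)\cdots(c+k-1),$$ i.e. of the orthogonal polynomial of degree $N$ for the weight $(1-x)^\alpha(1+x)^\beta$ on $]-1,1[$; these $N$ zeros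 are real, simple and lie in $]-1,1[$, that is, $-1<z_1<\dots<z_N<1$. Then there is a positive definite matrix $\Sigma$ whose inverse $\Sigma^{-1}=S=(s_{i,j})_{i,j=1,\dots,N}$ is given by $$s_{j,j}=\sum_{l\ne j}\frac{1}{(z_j-z_l)^2}+\frac{a+b}{2}\,\frac{1}{(1-z_j)^2}+\frac b2\,\frac1{(1+z_j)^2},\qquad s_{i,j}=\frac{-1}{(z_i-z_j)^2}\quad(i\ne j),$$ and $\sqrt\kappa\,(X_\kappa-z)$ converges in distribution for $\kappa\to\infty$ to the centered $N$-dimensional normal distribution $N(0,\Sigma)$. -/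

import Mathlib

open MeasureTheory ProbabilityTheory Filter Polynomial
open scoped ENNReal Topology

/-- The alcove `{x ∈ ℝ^N : -1 ≤ x₁ ≤ ... ≤ x_N ≤ 1}`. -/
def jacobiAlcove (N : ℕ) : Set (EuclideanSpace ℝ (Fin N)) :=
  {x | (∀ i j, i ≤ j → x i ≤ x j) ∧ ∀ i, -1 ≤ x i ∧ x i ≤ 1}

/-- The unnormalized joint density of the β-Jacobi ensemble with parameters `k₁, k₂, k₃`
(to be used on the alcove only). -/
noncomputable def jacobiWeight (N : ℕ) (k₁ k₂ k₃ : ℝ) (x : EuclideanSpace ℝ (Fin N)) : ℝ :=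
  (∏ i : Fin N, ∏ j ∈ Finset.Ioi i, (x j - x i) ^ k₃) *
    ∏ i : Fin N, (1 - x i) ^ ((k₁ + k₂) / 2 - 1 / 2) * (1 + x i) ^ (k₂ / 2 - 1 / 2)

/-- The measure on the alcove with Lebesgue density `jacobiWeight`, before normalization. -/
noncomputable def jacobiUnnormalized (N : ℕ) (k₁ k₂ k₃ : ℝ) :
    Measure (EuclideanSpace ℝ (Fin N)) :=
  (volume.restrict (jacobiAlcove N)).withDensity
    fun x => ENNReal.ofReal (jacobiWeight N k₁ k₂ k₃ x)

/-- The β-Jacobi ensemble `μ_k`, `k = (k₁, k₂, k₃)`: the normalization to total mass one of the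
measure on the alcove with Lebesgue density `jacobiWeight`. -/
noncomputable def jacobiEnsemble (N : ℕ) (k₁ k₂ k₃ : ℝ) :
    Measure (EuclideanSpace ℝ (Fin N)) :=
  (jacobiUnnormalized N k₁ k₂ k₃ Set.univ)⁻¹ • jacobiUnnormalized N k₁ k₂ k₃

/-- The classical Jacobi polynomial
`P_n^{(α,β)}(x) = (1/n!) ∑ₖ C(n,k) (n+α+β+1)ₖ (α+k+1)ₙ₋ₖ ((x-1)/2)^k`,
with `(c)ₖ = c (c+1) ⋯ (c+k-1)`. For `α, β > -1` these are the orthogonal polynomials for the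
weight `(1-x)^α (1+x)^β` on `(-1,1)`, normalized by `P_n^{(α,β)}(1) = (α+1)ₙ / n!`. -/
noncomputable def jacobiPolynomial (n : ℕ) (α β : ℝ) : ℝ[X] :=
  C ((n.factorial : ℝ)⁻¹) * ∑ k ∈ Finset.range (n + 1),
    C ((n.choose k : ℝ) * (ascPochhammer ℝ k).eval (n + α + β + 1) *
      (ascPochhammer ℝ (n - k)).eval (α + k + 1)) * (C (1 / 2) * (X - 1)) ^ k

/-- The vector `z₁ ≤ ... ≤ z_N` of the real zeros of `P_N^{(α,β)}`, listed in increasing order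
with multiplicities. The default entry `0` is used only if there are fewer than `N` real zeros. -/
noncomputable def jacobiZeros (N : ℕ) (α β : ℝ) : EuclideanSpace ℝ (Fin N) :=
  WithLp.toLp 2 fun i => ((jacobiPolynomial N α β).roots.sort (· ≤ ·)).getD i 0

/-- The matrix `S = (s_{i,j})` attached to a vector `z`. -/
noncomputable def jacobiInvCov (N : ℕ) (a b : ℝ) (z : EuclideanSpace ℝ (Fin N)) :
    Matrix (Fin N) (Fin N) ℝ :=
  Matrix.of fun i j =>
    if i = j then
      (∑ l ∈ Finset.univ.erase j, 1 / (z j - z l) ^ 2) +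
        (a + b) / 2 * (1 / (1 - z j) ^ 2) + b / 2 * (1 / (1 + z j) ^ 2)
    else -1 / (z i - z j) ^ 2

/-- For `k₁, k₂, k₃ ≥ 0` the β-Jacobi ensemble is a probability measure. -/
theorem isProbabilityMeasure_jacobiEnsemble (N : ℕ) {k₁ k₂ k₃ : ℝ} (h₁ : 0 ≤ k₁) (h₂ : 0 ≤ k₂)
    (h₃ : 0 ≤ k₃) : IsProbabilityMeasure (jacobiEnsemble N k₁ k₂ k₃) := by
  have hA : MeasurableSet (jacobiAlcove N) := by
    have : IsClosed (jacobiAlcove N) := by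
      simp only [jacobiAlcove, Set.ofPred_and, Set.ofPred_forall]
      refine IsClosed.inter ?_ ?_
      · exact isClosed_iInter fun i => isClosed_iInter fun j => isClosed_iInter fun _ =>
          isClosed_le (by fun_prop) (by fun_prop)
      · exact isClosed_iInter fun i => (isClosed_le (by fun_prop) (by fun_prop)).inter
          (isClosed_le (by fun_prop) (by fun_prop))
    exact this.measurableSet
  have hwm : Measurable (jacobiWeight N k₁ k₂ k₃) := by
    unfold jacobiWeight
    fun_prop
  have htot : jacobiUnnormalized N k₁ k₂ k₃ Set.univ =
      ∫⁻ x in jacobiAlcove N, ENNReal.ofReal (jacobiWeight N k₁ k₂ k₃ x) := by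
    rw [jacobiUnnormalized, withDensity_apply _ MeasurableSet.univ, Measure.restrict_univ]
  -- finiteness of the total mass
  have hfin : jacobiUnnormalized N k₁ k₂ k₃ Set.univ ≠ ∞ := by
    set p := (k₁ + k₂) / 2 - 1 / 2 with hp
    set q := k₂ / 2 - 1 / 2 with hq
    have hp1 : -1 < p := by linarith
    have hq1 : -1 < q := by linarith
    set g : ℝ → ℝ := fun t => (1 - t) ^ p * (1 + t) ^ q with hg
    have hgi : IntervalIntegrable g volume (-1) 1 := by
      have hq' : IntervalIntegrable (fun t : ℝ => (1 + t) ^ q) volume (-1) 0 := by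
        have h := (intervalIntegral.intervalIntegrable_rpow' (a := 0) (b := 1) hq1).comp_add_left 1
        simpa using h
      have hp' : IntervalIntegrable (fun t : ℝ => (1 - t) ^ p) volume 0 1 := by
        have h := (intervalIntegral.intervalIntegrable_rpow' (a := 1) (b := 0) hp1).comp_sub_left 1
        simpa using h
      have e1 : IntervalIntegrable g volume (-1) 0 := by
        refine hq'.continuousOn_mul (g := fun t : ℝ => (1 - t) ^ p) ?_
        refine ContinuousOn.rpow_const (by fun_prop) fun t ht => Or.inl ?_
        rw [Set.uIcc_of_le (by norm_num)] at ht
        have := ht.2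
        linarith
      have e2 : IntervalIntegrable g volume 0 1 := by
        refine hp'.mul_continuousOn (g := fun t : ℝ => (1 + t) ^ q) ?_
        refine ContinuousOn.rpow_const (by fun_prop) fun t ht => Or.inl ?_
        rw [Set.uIcc_of_le (by norm_num)] at ht
        have := ht.1
        linarith
      exact e1.trans e2
    set G : ℝ → ℝ := (Set.Icc (-1 : ℝ) 1).indicator g with hG
    have hGi : Integrable G volume := by
      rw [hG, integrable_indicator_iff measurableSet_Icc]
      exact (intervalIntegrable_iff_integrableOn_Icc_of_le (by norm_num)).1 hgi
    have hprod : Integrable (fun x : EuclideanSpace ℝ (Fin N) => ∏ i, G (x i)) volume := by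
      have h : Integrable (fun x : Fin N → ℝ => ∏ i, G (x i)) volume :=
        Integrable.fintype_prod (fun _ => hGi)
      rw [← (PiLp.volume_preserving_toLp (Fin N)).integrable_comp_emb
        (MeasurableEquiv.toLp 2 (Fin N → ℝ)).measurableEmbedding]
      exact h
    have hK := (hprod.const_mul (∏ i : Fin N, ∏ _j ∈ Finset.Ioi i, (2 : ℝ) ^ k₃)).lintegral_lt_top
    rw [htot]
    refine ((lt_of_le_of_lt ?_ hK)).ne
    refine le_trans (setLIntegral_mono' hA (g := fun x => ENNReal.ofReal
      ((∏ i : Fin N, ∏ _j ∈ Finset.Ioi i, (2 : ℝ) ^ k₃) * ∏ i, G (x i))) ?_)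
      (setLIntegral_le_lintegral _ _)
    intro x hx
    refine ENNReal.ofReal_le_ofReal ?_
    have hGx : ∀ i, G (x i) = (1 - x i) ^ p * (1 + x i) ^ q := fun i => by
      rw [hG, Set.indicator_of_mem (show x i ∈ Set.Icc (-1 : ℝ) 1 from hx.2 i)]
    simp only [jacobiWeight, hGx]
    refine mul_le_mul_of_nonneg_right ?_ ?_
    · refine Finset.prod_le_prod (fun i _ => Finset.prod_nonneg fun j hj =>
        Real.rpow_nonneg ?_ _) fun i _ => Finset.prod_le_prod (fun j hj =>
        Real.rpow_nonneg ?_ _) fun j hj => Real.rpow_le_rpow ?_ ?_ h₃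
      · exact sub_nonneg.2 (hx.1 i j (Finset.mem_Ioi.1 hj).le)
      · exact sub_nonneg.2 (hx.1 i j (Finset.mem_Ioi.1 hj).le)
      · exact sub_nonneg.2 (hx.1 i j (Finset.mem_Ioi.1 hj).le)
      · have h1 := (hx.2 i).1
        have h2 := (hx.2 j).2
        linarith
    · refine Finset.prod_nonneg fun i _ => mul_nonneg (Real.rpow_nonneg ?_ _)
        (Real.rpow_nonneg ?_ _)
      · have := (hx.2 i).2
        linarith
      · have := (hx.2 i).1
        linarith
  -- positivity of the total mass
  have hpos : jacobiUnnormalized N k₁ k₂ k₃ Set.univ ≠ 0 := by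
    set U : Set (EuclideanSpace ℝ (Fin N)) :=
      {x | (∀ i j, i < j → x i < x j) ∧ ∀ i, -1 < x i ∧ x i < 1} with hU
    have hUo : IsOpen U := by
      simp only [hU, Set.ofPred_and, Set.ofPred_forall]
      refine IsOpen.inter ?_ ?_
      · exact isOpen_iInter_of_finite fun i => isOpen_iInter_of_finite fun j =>
          isOpen_iInter_of_finite fun _ => isOpen_lt (by fun_prop) (by fun_prop)
      · exact isOpen_iInter_of_finite fun i => (isOpen_lt (by fun_prop) (by fun_prop)).inter
          (isOpen_lt (by fun_prop) (by fun_prop))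
    have hUn : U.Nonempty := by
      refine ⟨WithLp.toLp 2 fun i => (i : ℝ) / N, ?_, fun i => ?_⟩
      · intro i j hij
        have hN : (0 : ℝ) < N := by exact_mod_cast i.pos
        have : (i : ℝ) < (j : ℝ) := by exact_mod_cast hij
        simpa using div_lt_div_of_pos_right this hN
      · have hN : (0 : ℝ) < N := by exact_mod_cast i.pos
        have h1 : (i : ℝ) < N := by exact_mod_cast i.isLt
        have h2 : (0 : ℝ) ≤ (i : ℝ) / N := by positivity
        have h3 : (i : ℝ) / N < 1 := (div_lt_one hN).2 h1
        exact ⟨by change -1 < (i : ℝ) / N; linarith, h3⟩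
    have hUA : U ⊆ jacobiAlcove N := fun x hx =>
      ⟨fun i j hij => by
        rcases hij.eq_or_lt with h | h
        · rw [h]
        · exact (hx.1 i j h).le, fun i => ⟨(hx.2 i).1.le, (hx.2 i).2.le⟩⟩
    have hUw : ∀ x ∈ U, 0 < jacobiWeight N k₁ k₂ k₃ x := by
      intro x hx
      refine mul_pos (Finset.prod_pos fun i _ => Finset.prod_pos fun j hj =>
        Real.rpow_pos_of_pos (sub_pos.2 (hx.1 i j (Finset.mem_Ioi.1 hj))) _)
        (Finset.prod_pos fun i _ => mul_pos (Real.rpow_pos_of_pos ?_ _)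
          (Real.rpow_pos_of_pos ?_ _))
      · have := (hx.2 i).2
        linarith
      · have := (hx.2 i).1
        linarith
    rw [htot, ← pos_iff_ne_zero, setLIntegral_pos_iff (by fun_prop)]
    refine lt_of_lt_of_le (hUo.measure_pos volume hUn) (measure_mono fun x hx => ⟨?_, hUA hx⟩)
    simpa [Function.mem_support] using hUw x hx
  refine ⟨?_⟩
  rw [jacobiEnsemble, Measure.smul_apply, smul_eq_mul, ENNReal.inv_mul_cancel hpos hfin]

theorem eval_derivative_prod_X_sub_C {ι : Type*} [DecidableEq ι] (s : Finset ι) (u : ι → ℝ) (x : ℝ)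
    (hx : ∀ j ∈ s, x ≠ u j) :
    (derivative (∏ j ∈ s, (X - C (u j)))).eval x =
      (∏ j ∈ s, (X - C (u j))).eval x * ∑ j ∈ s, (x - u j)⁻¹ := by
  induction s using Finset.induction_on with
  | empty => simp
  | insert i s hi ih =>
    have h1 : x - u i ≠ 0 := sub_ne_zero.2 (hx i (Finset.mem_insert_self i s))
    have h2 := ih fun j hj => hx j (Finset.mem_insert_of_mem hj)
    rw [Finset.prod_insert hi, Finset.sum_insert hi, derivative_mul, eval_add, eval_mul, eval_mul,
      h2, eval_mul]
    simp only [derivative_sub, derivative_X, derivative_C, eval_sub, eval_X, eval_C, eval_one,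
      sub_zero]
    field_simp

/-- At a node of a polynomial with simple real zeros, the second derivative is determined by the
first one and the mutual distances of the zeros. -/
theorem eval_derivative_derivative_prod_X_sub_C {ι : Type*} [Fintype ι] [DecidableEq ι] {u : ι → ℝ}
    (hu : Function.Injective u) (i : ι) :
    (derivative (derivative (∏ j, (X - C (u j))))).eval (u i) =
      2 * (derivative (∏ j, (X - C (u j)))).eval (u i) * ∑ j, (u i - u j)⁻¹ := by
  have hT := eval_derivative_prod_X_sub_C (Finset.univ.erase i) u (u i)
    fun j hj h => (Finset.ne_of_mem_erase hj) (hu h).symm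
  rw [← Finset.mul_prod_erase Finset.univ _ (Finset.mem_univ i),
    ← Finset.add_sum_erase Finset.univ _ (Finset.mem_univ i)]
  simp only [derivative_mul, derivative_sub, derivative_X, derivative_C, eval_add, eval_mul,
    derivative_add, eval_sub, eval_X, eval_C, hT, sub_self, sub_zero, inv_zero, zero_mul, one_mul,
    zero_add, add_zero]
  ring

/-- The Jacobi differential operator in the variable `u = (x - 1) / 2`. -/
noncomputable def jacobiOperator (n : ℕ) (α β : ℝ) (R : ℝ[X]) : ℝ[X] :=
  X * (derivative (derivative R)) + X * (X * derivative (derivative R)) +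
    (C (α + 1) * derivative R + C (α + β + 2) * (X * derivative R)) - C (n * (n + α + β + 1)) * R

theorem coeff_jacobiOperator (n : ℕ) (α β : ℝ) (R : ℝ[X]) (k : ℕ) :
    (jacobiOperator n α β R).coeff k =
      (k + 1) * (k + 1 + α) * R.coeff (k + 1) - (n - k) * (n + k + α + β + 1) * R.coeff k := by
  rcases k with _ | _ | k
  all_goals
    simp only [jacobiOperator, coeff_sub, coeff_add, coeff_C_mul, coeff_X_mul, coeff_derivative,
      coeff_X_mul_zero, Nat.cast_add, Nat.cast_one, Nat.cast_zero]
    ring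

theorem eval_jacobiOperator (n : ℕ) (α β : ℝ) (R : ℝ[X]) (x : ℝ) :
    (jacobiOperator n α β R).eval x =
      x * (1 + x) * (derivative (derivative R)).eval x +
        (α + 1 + (α + β + 2) * x) * (derivative R).eval x - n * (n + α + β + 1) * R.eval x := by
  simp only [jacobiOperator, eval_sub, eval_add, eval_mul, eval_X, eval_C]
  ring

/-- The coefficients of `n! P_n^{(α,β)}` in powers of `(x - 1) / 2`. -/
noncomputable def jacobiCoeff (n : ℕ) (α β : ℝ) (k : ℕ) : ℝ :=
  (n.choose k : ℝ) * (ascPochhammer ℝ k).eval (n + α + β + 1) *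
    (ascPochhammer ℝ (n - k)).eval (α + k + 1)

theorem ascPochhammer_succ_eval_left (m : ℕ) (x : ℝ) :
    (ascPochhammer ℝ (m + 1)).eval x = x * (ascPochhammer ℝ m).eval (x + 1) := by
  rw [ascPochhammer_succ_left]
  simp

theorem jacobiCoeff_succ {n k : ℕ} (hk : k < n) (α β : ℝ) :
    (k + 1) * (k + 1 + α) * jacobiCoeff n α β (k + 1) =
      (n - k) * (n + k + α + β + 1) * jacobiCoeff n α β k := by
  have h1 : ((n.choose (k + 1) : ℕ) : ℝ) * (k + 1) = n.choose k * (n - k) := by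
    have := Nat.choose_succ_right_eq n k
    rw [← Nat.cast_sub hk.le]
    exact_mod_cast this
  have h2 : (ascPochhammer ℝ (n - k)).eval (α + k + 1) =
      (α + k + 1) * (ascPochhammer ℝ (n - (k + 1))).eval (α + (k + 1 : ℕ) + 1) := by
    rw [show n - k = n - (k + 1) + 1 by omega, ascPochhammer_succ_eval_left]
    push_cast
    ring_nf
  rw [jacobiCoeff, jacobiCoeff, h2, ascPochhammer_succ_eval]
  linear_combination ((k + 1 + α) * ((ascPochhammer ℝ k).eval (n + α + β + 1) *
    (n + α + β + 1 + k)) * (ascPochhammer ℝ (n - (k + 1))).eval (α + (k + 1 : ℕ) + 1)) * h1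

theorem jacobiPolynomial_eq_comp (n : ℕ) (α β : ℝ) :
    jacobiPolynomial n α β = C ((n.factorial : ℝ)⁻¹) *
      (∑ k ∈ Finset.range (n + 1), C (jacobiCoeff n α β k) * X ^ k).comp (C (1 / 2) * (X - 1)) := by
  rw [jacobiPolynomial, Polynomial.sum_comp]
  simp [jacobiCoeff]

/-- If the points `z i` are a critical point of the logarithmic energy then their nodal polynomial
is proportional to the Jacobi polynomial (Stieltjes). -/
theorem jacobiPolynomial_eq_of_critical {n : ℕ} {α β : ℝ} (hα : -1 < α) {z : Fin n → ℝ}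
    (hz : Function.Injective z) (hz1 : ∀ i, -1 < z i ∧ z i < 1)
    (hcrit : ∀ i, ∑ j, (z i - z j)⁻¹ - (α + 1) / 2 / (1 - z i) + (β + 1) / 2 / (1 + z i) = 0) :
    ∃ c : ℝ, c ≠ 0 ∧ jacobiPolynomial n α β = C c * ∏ i, (X - C (z i)) := by
  set u : Fin n → ℝ := fun i => (z i - 1) / 2 with hu
  have hui : Function.Injective u := fun i j h => hz (by simp only [hu] at h; linarith)
  set R : ℝ[X] := ∏ j, (X - C (u j)) with hR
  have hRm : R.Monic := monic_prod_of_monic _ _ fun i _ => monic_X_sub_C _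
  have hRd : R.natDegree = n := by
    rw [hR, natDegree_prod_of_monic _ _ fun i _ => monic_X_sub_C _]
    simp
  have hRn : R.coeff n = 1 := by rw [← hRd]; exact hRm
  have hR0 : ∀ k, n < k → R.coeff k = 0 := fun k hk =>
    coeff_eq_zero_of_natDegree_lt (by rwa [hRd])
  have hop : jacobiOperator n α β R = 0 := by
    refine eq_zero_of_degree_lt_of_eval_index_eq_zero Finset.univ
      (v := u) (fun i _ j _ h => hui h) ?_ ?_
    · rw [Finset.card_univ, Fintype.card_fin, degree_lt_iff_coeff_zero]
      intro k hk
      rw [coeff_jacobiOperator, hR0 (k + 1) (by omega)]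
      rcases hk.eq_or_lt with h | h
      · simp [h]
      · simp [hR0 k h]
    · intro i _
      have h0 : R.eval (u i) = 0 := by
        rw [hR, eval_prod]
        exact Finset.prod_eq_zero (Finset.mem_univ i) (by simp)
      have hs : ∑ j, (u i - u j)⁻¹ = 2 * ∑ j, (z i - z j)⁻¹ := by
        rw [Finset.mul_sum]
        refine Finset.sum_congr rfl fun j _ => ?_
        rw [show u i - u j = (z i - z j) / 2 by simp only [hu]; ring, inv_div, div_eq_mul_inv]
      have h1 : (1 - z i) ≠ 0 := by linarith [(hz1 i).2]
      have h2 : (1 + z i) ≠ 0 := by linarith [(hz1 i).1]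
      rw [eval_jacobiOperator, h0, hR, eval_derivative_derivative_prod_X_sub_C hui, hs]
      have h3 : ∑ j, (z i - z j)⁻¹ = (α + 1) / 2 / (1 - z i) - (β + 1) / 2 / (1 + z i) := by
        linarith [hcrit i]
      rw [h3]
      simp only [hu]
      field_simp
      ring
  have hrec : ∀ k, (k + 1) * (k + 1 + α) * R.coeff (k + 1) =
      (n - k) * (n + k + α + β + 1) * R.coeff k := fun k => by
    have := coeff_jacobiOperator n α β R k
    rw [hop, coeff_zero] at this
    linarith
  have hc0 : jacobiCoeff n α β 0 ≠ 0 := by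
    have : 0 < (ascPochhammer ℝ n).eval (α + 1) := ascPochhammer_pos n _ (by linarith)
    simpa [jacobiCoeff] using this.ne'
  set d := R.coeff 0 / jacobiCoeff n α β 0 with hd
  have hco : ∀ k ≤ n, R.coeff k = d * jacobiCoeff n α β k := by
    intro k
    induction k with
    | zero => intro _; rw [hd, div_mul_cancel₀ _ hc0]
    | succ k ih =>
      intro hk
      have hpos : ((k : ℝ) + 1) * (k + 1 + α) ≠ 0 := by
        have : (0 : ℝ) ≤ k := k.cast_nonneg
        have : (0 : ℝ) < k + 1 + α := by linarith
        positivity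
      refine mul_left_cancel₀ hpos ?_
      rw [hrec k, ih (by omega)]
      linear_combination -d * jacobiCoeff_succ (n := n) (k := k) (by omega) α β
  have hd0 : d ≠ 0 := by
    intro h
    have := hco n le_rfl
    rw [hRn, h, zero_mul] at this
    exact one_ne_zero this
  have hJ : ∑ k ∈ Finset.range (n + 1), C (jacobiCoeff n α β k) * X ^ k = C d⁻¹ * R := by
    rw [R.as_sum_range' (n + 1) (by omega), Finset.mul_sum]
    refine Finset.sum_congr rfl fun k hk => ?_
    rw [← C_mul_X_pow_eq_monomial, hco k (by simpa [Nat.lt_succ_iff] using hk), ← mul_assoc,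
      ← C_mul, inv_mul_cancel_left₀ hd0]
  have hRc : R.comp (C (1 / 2) * (X - 1)) = C ((1 / 2 : ℝ) ^ n) * ∏ i, (X - C (z i)) := by
    have : ∀ i : Fin n, (X - C (u i)).comp (C (1 / 2) * (X - 1)) = C (1 / 2) * (X - C (z i)) := by
      intro i
      have h : C (z i) = 2 * C (u i) + 1 := by
        rw [← C_1, show (2 : ℝ[X]) = C 2 from rfl, ← C_mul, ← C_add]
        congr 1
        simp only [hu]
        ring
      have h2 : (C (1 / 2) * 2 : ℝ[X]) = 1 := by
        rw [show (2 : ℝ[X]) = C 2 from rfl, ← C_mul]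
        norm_num
      rw [h, sub_comp, X_comp, C_comp]
      linear_combination C (u i) * h2
    rw [hR, prod_comp, Finset.prod_congr rfl fun i _ => this i, Finset.prod_mul_distrib,
      Finset.prod_const, Finset.card_univ, Fintype.card_fin, C_pow]
  refine ⟨(n.factorial : ℝ)⁻¹ * (d⁻¹ * (1 / 2) ^ n), ?_, ?_⟩
  · have := n.factorial_ne_zero
    positivity
  · rw [jacobiPolynomial_eq_comp, hJ, mul_comp, C_comp, hRc]
    simp only [C_mul, mul_assoc]

theorem jacobiZeros_eq_of_roots {n : ℕ} {α β c : ℝ} (hc : c ≠ 0) {z : EuclideanSpace ℝ (Fin n)}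
    (hz : StrictMono fun i => z i)
    (h : jacobiPolynomial n α β = C c * ∏ i, (X - C (z i))) : jacobiZeros n α β = z := by
  have hr : (jacobiPolynomial n α β).roots = (List.ofFn fun i => z i : List ℝ) := by
    have : ∏ i, (X - C (z i)) =
        (((List.ofFn fun i => z i : List ℝ) : Multiset ℝ).map fun a => X - C a).prod := by
      rw [Multiset.map_coe, Multiset.prod_coe, List.map_ofFn, List.prod_ofFn]
      rfl
    rw [h, roots_C_mul _ hc, this, roots_multiset_prod_X_sub_C]
  have hs : (jacobiPolynomial n α β).roots.sort (· ≤ ·) = List.ofFn fun i => z i := by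
    rw [hr, Multiset.coe_sort]
    exact List.mergeSort_eq_self _ (List.pairwise_ofFn.2 fun i j hij => (hz hij).le)
  ext i
  simp [jacobiZeros, hs]

/-- The index set of the walls of the alcove: pairs `i < j`, right ends, left ends. -/
abbrev JacobiWall (N : ℕ) : Type := {p : Fin N × Fin N // p.1 < p.2} ⊕ (Fin N ⊕ Fin N)

/-- The affine forms `x j - x i`, `1 - x i`, `1 + x i` that are nonnegative on the alcove. -/
def wallForm {N : ℕ} (x : EuclideanSpace ℝ (Fin N)) : JacobiWall N → ℝ
  | .inl p => x p.1.2 - x p.1.1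
  | .inr (.inl i) => 1 - x i
  | .inr (.inr i) => 1 + x i

/-- The linear parts of the forms `wallForm`. -/
def wallLin {N : ℕ} (v : EuclideanSpace ℝ (Fin N)) : JacobiWall N → ℝ
  | .inl p => v p.1.2 - v p.1.1
  | .inr (.inl i) => -v i
  | .inr (.inr i) => v i

/-- The leading exponents of the forms in the density. -/
noncomputable def wallExponent (N : ℕ) (a b : ℝ) : JacobiWall N → ℝ
  | .inl _ => 1
  | .inr (.inl _) => (a + b) / 2
  | .inr (.inr _) => b / 2

/-- The corrections to the exponents of the forms in the density. -/
noncomputable def wallShift (N : ℕ) : JacobiWall N → ℝ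
  | .inl _ => 0
  | .inr _ => 1 / 2

section Wall

variable {N : ℕ}

theorem wallForm_add (x v : EuclideanSpace ℝ (Fin N)) (m : JacobiWall N) :
    wallForm (x + v) m = wallForm x m + wallLin v m := by
  rcases m with p | i | i <;> simp [wallForm, wallLin] <;> ring

theorem wallLin_smul (t : ℝ) (v : EuclideanSpace ℝ (Fin N)) (m : JacobiWall N) :
    wallLin (t • v) m = t * wallLin v m := by
  rcases m with p | i | i <;> simp [wallLin]; ring

theorem continuous_wallForm (m : JacobiWall N) :
    Continuous fun x : EuclideanSpace ℝ (Fin N) => wallForm x m := by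
  rcases m with p | i | i <;> simp only [wallForm] <;> fun_prop

theorem wallExponent_pos {a b : ℝ} (ha : 0 ≤ a) (hb : 0 < b) (m : JacobiWall N) :
    0 < wallExponent N a b m := by
  rcases m with p | i | i <;> simp only [wallExponent] <;> positivity

theorem mem_jacobiAlcove_iff {x : EuclideanSpace ℝ (Fin N)} :
    x ∈ jacobiAlcove N ↔ ∀ m, 0 ≤ wallForm x m := by
  constructor
  · rintro ⟨h1, h2⟩ (p | i | i)
    · exact sub_nonneg.2 (h1 _ _ p.2.le)
    · exact sub_nonneg.2 (h2 i).2
    · simp only [wallForm]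
      linarith [(h2 i).1]
  · intro h
    refine ⟨fun i j hij => ?_, fun i => ⟨?_, ?_⟩⟩
    · rcases hij.eq_or_lt with rfl | h'
      · rfl
      · exact sub_nonneg.1 (h (.inl ⟨(i, j), h'⟩))
    · have := h (.inr (.inr i))
      simp only [wallForm] at this
      linarith
    · exact sub_nonneg.1 (h (.inr (.inl i)))

theorem isClosed_jacobiAlcove : IsClosed (jacobiAlcove N) := by
  have : jacobiAlcove N = ⋂ m, {x | 0 ≤ wallForm x m} := by
    ext x
    simp [mem_jacobiAlcove_iff]
  rw [this]
  exact isClosed_iInter fun m => isClosed_le continuous_const (continuous_wallForm m)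

theorem isCompact_jacobiAlcove : IsCompact (jacobiAlcove N) := by
  refine IsCompact.of_isClosed_subset ((isCompact_Icc (a := fun _ : Fin N => (-1 : ℝ))
    (b := fun _ => 1)).image (PiLp.continuous_toLp 2 _)) isClosed_jacobiAlcove fun x hx => ?_
  exact ⟨x.ofLp, ⟨fun i => (hx.2 i).1, fun i => (hx.2 i).2⟩, rfl⟩

theorem wallForm_le_two {x : EuclideanSpace ℝ (Fin N)} (hx : x ∈ jacobiAlcove N)
    (m : JacobiWall N) : wallForm x m ≤ 2 := by
  rcases m with p | i | i <;> simp only [wallForm]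
  · linarith [(hx.2 p.1.2).2, (hx.2 p.1.1).1]
  · linarith [(hx.2 i).1]
  · linarith [(hx.2 i).2]

theorem exists_wallForm_pos (N : ℕ) : ∃ x : EuclideanSpace ℝ (Fin N), ∀ m, 0 < wallForm x m := by
  refine ⟨WithLp.toLp 2 fun i => (i : ℝ) / N, ?_⟩
  rintro (⟨⟨i, j⟩, hij⟩ | i | i) <;> simp only [wallForm]
  · have hN : (0 : ℝ) < N := by exact_mod_cast i.pos
    have : (i : ℝ) < (j : ℝ) := by exact_mod_cast hij
    exact sub_pos.2 (div_lt_div_of_pos_right this hN)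
  · have hN : (0 : ℝ) < N := by exact_mod_cast i.pos
    have : (i : ℝ) < N := by exact_mod_cast i.isLt
    exact sub_pos.2 ((div_lt_one hN).2 this)
  · positivity

@[to_additive]
theorem prod_pairs_eq_ite {M : Type*} [CommMonoid M] (f : Fin N → Fin N → M) :
    ∏ p : {p : Fin N × Fin N // p.1 < p.2}, f p.1.1 p.1.2 =
      ∏ i, ∏ j, if i < j then f i j else 1 := by
  rw [← Fintype.prod_prod_type' (fun i j => if i < j then f i j else 1), ← Finset.prod_filter]
  exact (Finset.prod_subtype (p := fun p : Fin N × Fin N => p.1 < p.2) _ (by simp)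
    fun p => f p.1 p.2).symm

theorem prod_pairs_eq_Ioi {M : Type*} [CommMonoid M] (f : Fin N → Fin N → M) :
    ∏ p : {p : Fin N × Fin N // p.1 < p.2}, f p.1.1 p.1.2 = ∏ i, ∏ j ∈ Finset.Ioi i, f i j := by
  rw [prod_pairs_eq_ite]
  refine Finset.prod_congr rfl fun i _ => ?_
  rw [← Finset.prod_filter]
  exact Finset.prod_congr (by ext; simp) fun _ _ => rfl

theorem sum_pairs_eq_half (f : Fin N → Fin N → ℝ) (hf : ∀ i j, f i j = f j i)
    (h0 : ∀ i, f i i = 0) :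
    ∑ p : {p : Fin N × Fin N // p.1 < p.2}, f p.1.1 p.1.2 = (1 / 2) * ∑ i, ∑ j, f i j := by
  have h2 : ∑ i, ∑ j, (if i < j then f i j else 0) = ∑ i, ∑ j, if j < i then f i j else 0 := by
    rw [Finset.sum_comm]
    exact Finset.sum_congr rfl fun i _ => Finset.sum_congr rfl fun j _ => by rw [hf]
  have h3 : ∑ i, ∑ j, f i j =
      (∑ i, ∑ j, if i < j then f i j else 0) + ∑ i, ∑ j, if j < i then f i j else 0 := by
    simp_rw [← Finset.sum_add_distrib]
    refine Finset.sum_congr rfl fun i _ => Finset.sum_congr rfl fun j _ => ?_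
    rcases lt_trichotomy i j with h | rfl | h
    · simp [h, h.not_gt]
    · simp [h0]
    · simp [h, h.not_gt]
  rw [h3, ← h2, sum_pairs_eq_ite]
  ring

theorem jacobiWeight_eq_prod_wall (a b κ : ℝ) (x : EuclideanSpace ℝ (Fin N)) :
    jacobiWeight N (κ * a) (κ * b) κ x =
      ∏ m, wallForm x m ^ (κ * wallExponent N a b m - wallShift N m) := by
  rw [Fintype.prod_sum_type, Fintype.prod_sum_type, jacobiWeight, Finset.prod_mul_distrib]
  simp only [wallForm, wallExponent, wallShift]
  rw [prod_pairs_eq_Ioi fun i j => (x j - x i) ^ (κ * 1 - 0)]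
  simp only [mul_one, sub_zero, ← mul_add, mul_div_assoc]

theorem sum_wallLin_div_wallForm (a b : ℝ) (z v : EuclideanSpace ℝ (Fin N)) :
    ∑ m, wallExponent N a b m * (wallLin v m / wallForm z m) =
      ∑ i, v i * (∑ j, (z i - z j)⁻¹ - (a + b) / 2 / (1 - z i) + b / 2 / (1 + z i)) := by
  rw [Fintype.sum_sum_type, Fintype.sum_sum_type]
  simp only [wallForm, wallExponent, wallLin, one_mul]
  rw [sum_pairs_eq_half (fun i j => (v j - v i) / (z j - z i))
    (fun i j => by rw [← neg_sub (v i), ← neg_sub (z i), neg_div_neg_eq]) (fun i => by simp)]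
  have : ∑ i, ∑ j, (v j - v i) / (z j - z i) = 2 * ∑ i, v i * ∑ j, (z i - z j)⁻¹ := by
    have h1 : ∑ i, ∑ j, (v j - v i) / (z j - z i) =
        ∑ i, ∑ j, v j * (z j - z i)⁻¹ + ∑ i, ∑ j, v i * (z i - z j)⁻¹ := by
      simp_rw [← Finset.sum_add_distrib]
      refine Finset.sum_congr rfl fun i _ => Finset.sum_congr rfl fun j _ => ?_
      rw [← neg_sub (z j) (z i), inv_neg]
      ring
    rw [h1, Finset.sum_comm, ← two_mul]
    simp_rw [Finset.mul_sum]
  rw [this, ← mul_assoc, one_div, inv_mul_cancel₀ two_ne_zero, one_mul, ← Finset.sum_add_distrib,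
    ← Finset.sum_add_distrib]
  exact Finset.sum_congr rfl fun i _ => by ring

theorem sum_wallLin_sq (a b : ℝ) (z v : EuclideanSpace ℝ (Fin N)) :
    ∑ m, wallExponent N a b m * (wallLin v m / wallForm z m) ^ 2 =
      v.ofLp ⬝ᵥ (jacobiInvCov N a b z).mulVec v.ofLp := by
  rw [Fintype.sum_sum_type, Fintype.sum_sum_type]
  simp only [wallForm, wallExponent, wallLin, one_mul]
  rw [sum_pairs_eq_half (fun i j => ((v j - v i) / (z j - z i)) ^ 2)
    (fun i j => by rw [← neg_sub (v i), ← neg_sub (z i), neg_div_neg_eq]) (fun i => by simp)]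
  have hM : ∀ i j, jacobiInvCov N a b z i j = (if i = j then ∑ l, 1 / (z i - z l) ^ 2 +
      (a + b) / 2 * (1 / (1 - z i) ^ 2) + b / 2 * (1 / (1 + z i) ^ 2) else 0) -
      1 / (z i - z j) ^ 2 := by
    intro i j
    simp only [jacobiInvCov, Matrix.of_apply]
    split_ifs with h
    · subst h
      rw [← Finset.add_sum_erase Finset.univ _ (Finset.mem_univ i)]
      simp
    · ring
  have h2 : v.ofLp ⬝ᵥ (jacobiInvCov N a b z).mulVec v.ofLp =
      ∑ i, v i ^ 2 * (∑ l, 1 / (z i - z l) ^ 2 + (a + b) / 2 * (1 / (1 - z i) ^ 2) +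
        b / 2 * (1 / (1 + z i) ^ 2)) - ∑ i, ∑ j, v i * v j * (1 / (z i - z j) ^ 2) := by
    rw [← Finset.sum_sub_distrib]
    refine Finset.sum_congr rfl fun i _ => ?_
    rw [Matrix.mulVec, dotProduct, Finset.sum_congr rfl fun j _ => by rw [hM i j]]
    simp only [sub_mul, Finset.sum_sub_distrib, ite_mul, zero_mul, Finset.sum_ite_eq,
      Finset.mem_univ, if_true, mul_sub, Finset.mul_sum]
    congr 1
    · ring
    · exact Finset.sum_congr rfl fun j _ => by ring
  have h3 : ∑ i, ∑ j, ((v j - v i) / (z j - z i)) ^ 2 =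
      2 * ∑ i, ∑ j, v i ^ 2 * (1 / (z i - z j) ^ 2) -
        2 * ∑ i, ∑ j, v i * v j * (1 / (z i - z j) ^ 2) := by
    have h4 : ∑ i, ∑ j, v i ^ 2 * (1 / (z i - z j) ^ 2) =
        ∑ i, ∑ j, v j ^ 2 * (1 / (z i - z j) ^ 2) := by
      rw [Finset.sum_comm]
      refine Finset.sum_congr rfl fun i _ => Finset.sum_congr rfl fun j _ => ?_
      rw [← neg_sub (z i), neg_sq]
    rw [two_mul]
    nth_rw 2 [h4]
    simp_rw [Finset.mul_sum, ← Finset.sum_add_distrib, ← Finset.sum_sub_distrib]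
    refine Finset.sum_congr rfl fun i _ => Finset.sum_congr rfl fun j _ => ?_
    rw [← neg_sub (z i) (z j), div_neg, neg_sq, div_pow]
    ring
  rw [h3, h2]
  simp only [mul_add, Finset.sum_add_distrib, Finset.mul_sum]
  have e1 : ∀ i, (a + b) / 2 * (-v i / (1 - z i)) ^ 2 =
      v i ^ 2 * ((a + b) / 2 * (1 / (1 - z i) ^ 2)) := fun i => by rw [div_pow]; ring
  have e2 : ∀ i, b / 2 * (v i / (1 + z i)) ^ 2 =
      v i ^ 2 * (b / 2 * (1 / (1 + z i) ^ 2)) := fun i => by rw [div_pow]; ring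
  simp only [e1, e2, ← Finset.mul_sum]
  ring

theorem sum_wallLin_sq_ge {a b : ℝ} (ha : 0 ≤ a) (hb : 0 < b) {z : EuclideanSpace ℝ (Fin N)}
    (hz : ∀ m, 0 < wallForm z m) (v : EuclideanSpace ℝ (Fin N)) :
    b / 8 * ‖v‖ ^ 2 ≤ ∑ m, wallExponent N a b m * (wallLin v m / wallForm z m) ^ 2 := by
  have hA : z ∈ jacobiAlcove N := mem_jacobiAlcove_iff.2 fun m => (hz m).le
  have hnn : ∀ m, 0 ≤ wallExponent N a b m * (wallLin v m / wallForm z m) ^ 2 := fun m =>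
    mul_nonneg (wallExponent_pos ha hb m).le (sq_nonneg _)
  rw [Fintype.sum_sum_type, Fintype.sum_sum_type, EuclideanSpace.real_norm_sq_eq, Finset.mul_sum]
  refine le_add_of_nonneg_of_le (Finset.sum_nonneg fun _ _ => hnn _) <|
    le_add_of_nonneg_of_le (Finset.sum_nonneg fun _ _ => hnn _) <|
    Finset.sum_le_sum fun i _ => ?_
  have h1 := hz (.inr (.inr i))
  have h2 := wallForm_le_two hA (.inr (.inr i))
  have h3 : wallForm z (.inr (.inr i)) ^ 2 ≤ 4 := by nlinarith
  simp only [wallExponent, wallLin]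
  rw [div_pow, mul_div_assoc', le_div_iff₀ (by positivity)]
  nlinarith [mul_nonneg hb.le (sq_nonneg (v i))]

/-- The logarithmic energy has a critical point in the interior of the alcove. -/
theorem exists_critical_point (N : ℕ) {a b : ℝ} (ha : 0 ≤ a) (hb : 0 < b) :
    ∃ z : EuclideanSpace ℝ (Fin N), (∀ m, 0 < wallForm z m) ∧
      ∀ v, ∑ m, wallExponent N a b m * (wallLin v m / wallForm z m) = 0 := by
  have he := fun m => wallExponent_pos (N := N) ha hb m
  set V : EuclideanSpace ℝ (Fin N) → ℝ := fun x => ∏ m, wallForm x m ^ wallExponent N a b m with hV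
  have hVc : Continuous V := continuous_finsetProd _ fun m _ =>
    (continuous_wallForm m).rpow_const fun _ => Or.inr (he m).le
  obtain ⟨x, hx⟩ := exists_wallForm_pos N
  have hxA : x ∈ jacobiAlcove N := mem_jacobiAlcove_iff.2 fun m => (hx m).le
  obtain ⟨z, hzA, hz⟩ := isCompact_jacobiAlcove.exists_isMaxOn ⟨x, hxA⟩ hVc.continuousOn
  have hVz : V z ≠ 0 := ((Finset.prod_pos fun m _ => Real.rpow_pos_of_pos (hx m) _).trans_le
    (hz hxA)).ne'
  have hzpos : ∀ m, 0 < wallForm z m := fun m => by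
    refine (mem_jacobiAlcove_iff.1 hzA m).lt_of_ne' fun h => hVz ?_
    refine Finset.prod_eq_zero (Finset.mem_univ m) ?_
    rw [h, Real.zero_rpow (he m).ne']
  refine ⟨z, hzpos, fun v => ?_⟩
  set W : ℝ → ℝ := fun t => ∑ m, wallExponent N a b m *
    Real.log (wallForm z m + t * wallLin v m) with hW
  have hW' : HasDerivAt W (∑ m, wallExponent N a b m * (wallLin v m / wallForm z m)) 0 := by
    refine HasDerivAt.fun_sum fun m _ => HasDerivAt.const_mul _ ?_
    have h : HasDerivAt (fun t : ℝ => wallForm z m + t * wallLin v m) (wallLin v m) 0 := by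
      simpa using ((hasDerivAt_id (0 : ℝ)).mul_const (wallLin v m)).const_add (wallForm z m)
    simpa using h.log (by simpa using (hzpos m).ne')
  refine IsLocalMax.hasDerivAt_eq_zero ?_ hW'
  have hev : ∀ᶠ t in 𝓝 (0 : ℝ), ∀ m, 0 < wallForm z m + t * wallLin v m := by
    refine eventually_all.2 fun m => ?_
    have : ContinuousAt (fun t : ℝ => wallForm z m + t * wallLin v m) 0 := by fun_prop
    exact this.eventually_const_lt (by simpa using hzpos m)
  filter_upwards [hev] with t ht
  have hform : ∀ m, wallForm (z + t • v) m = wallForm z m + t * wallLin v m := fun m => by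
    rw [wallForm_add, wallLin_smul]
  have hle : V (z + t • v) ≤ V z :=
    hz (mem_jacobiAlcove_iff.2 fun m => by rw [hform]; exact (ht m).le)
  have hlog : ∀ y, (∀ m, 0 < wallForm y m) →
      Real.log (V y) = ∑ m, wallExponent N a b m * Real.log (wallForm y m) := fun y hy => by
    rw [hV, Real.log_prod fun m _ => (Real.rpow_pos_of_pos (hy m) _).ne']
    exact Finset.sum_congr rfl fun m _ => Real.log_rpow (hy m) _
  have hpos : ∀ m, 0 < wallForm (z + t • v) m := fun m => by rw [hform]; exact ht m
  have := Real.log_le_log (Finset.prod_pos fun m _ => Real.rpow_pos_of_pos (hpos m) _) hle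
  rw [hlog _ hpos, hlog _ hzpos] at this
  simpa [hW, hform] using this

theorem wallForm_pos_iff {x : EuclideanSpace ℝ (Fin N)} :
    (∀ m, 0 < wallForm x m) ↔ StrictMono (fun i => x i) ∧ ∀ i, -1 < x i ∧ x i < 1 := by
  constructor
  · intro h
    refine ⟨fun i j hij => sub_pos.1 (h (.inl ⟨(i, j), hij⟩)), fun i => ⟨?_, ?_⟩⟩
    · have := h (.inr (.inr i))
      simp only [wallForm] at this
      linarith
    · exact sub_pos.1 (h (.inr (.inl i)))
  · rintro ⟨h1, h2⟩ (p | i | i)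
    · exact sub_pos.2 (h1 p.2)
    · exact sub_pos.2 (h2 i).2
    · simp only [wallForm]
      linarith [(h2 i).1]

/-- The ordered zeros of the Jacobi polynomial are the critical point of the logarithmic energy. -/
theorem jacobiZeros_spec (N : ℕ) {a b : ℝ} (ha : 0 ≤ a) (hb : 0 < b) :
    (∀ m, 0 < wallForm (jacobiZeros N (a + b - 1) (b - 1)) m) ∧
    (∀ v, ∑ m, wallExponent N a b m *
      (wallLin v m / wallForm (jacobiZeros N (a + b - 1) (b - 1)) m) = 0) ∧
    ∀ i, (jacobiPolynomial N (a + b - 1) (b - 1)).IsRoot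
      (jacobiZeros N (a + b - 1) (b - 1) i) := by
  obtain ⟨z, hz, hcrit⟩ := exists_critical_point N ha hb
  obtain ⟨hmono, hmem⟩ := wallForm_pos_iff.1 hz
  have hc : ∀ i, ∑ j, (z i - z j)⁻¹ - (a + b - 1 + 1) / 2 / (1 - z i) +
      (b - 1 + 1) / 2 / (1 + z i) = 0 := fun i => by
    have := hcrit (EuclideanSpace.single i 1)
    rw [sum_wallLin_div_wallForm] at this
    simpa [Pi.single_apply] using this
  obtain ⟨c, hc0, hP⟩ := jacobiPolynomial_eq_of_critical (by linarith) hmono.injective hmem hc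
  rw [jacobiZeros_eq_of_roots hc0 hmono hP]
  refine ⟨hz, hcrit, fun i => ?_⟩
  rw [IsRoot, hP, eval_mul, eval_prod, Finset.prod_eq_zero (Finset.mem_univ i) (by simp), mul_zero]

end Wall

section Gaussian

variable {ι : Type*} [Fintype ι]

theorem integrable_exp_neg_mul_norm_sq {c : ℝ} (hc : 0 < c) :
    Integrable fun x : EuclideanSpace ℝ ι => Real.exp (-c * ‖x‖ ^ 2) := by
  have h := (GaussianFourier.integrable_cexp_neg_mul_sq_norm_add (V := EuclideanSpace ℝ ι)
    (b := (c : ℂ)) (by simpa using hc) 0 0).norm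
  refine h.congr (ae_of_all _ fun x => ?_)
  simp [Complex.norm_exp, ← Complex.ofReal_pow]

theorem stdGaussian_eq_withDensity :
    stdGaussian (EuclideanSpace ℝ ι) = volume.withDensity fun x => ENNReal.ofReal
      (Real.exp (-(1 / 2) * ‖x‖ ^ 2) /
        ∫ y : EuclideanSpace ℝ ι, Real.exp (-(1 / 2) * ‖y‖ ^ 2)) := by
  have hint := integrable_exp_neg_mul_norm_sq (ι := ι) (c := 1 / 2) (by norm_num)
  set Z := ∫ y : EuclideanSpace ℝ ι, Real.exp (-(1 / 2) * ‖y‖ ^ 2) with hZ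
  have hZ0 : 0 < Z := integral_exp_pos hint
  have : IsFiniteMeasure ((volume : Measure (EuclideanSpace ℝ ι)).withDensity fun x =>
      ENNReal.ofReal (Real.exp (-(1 / 2) * ‖x‖ ^ 2) / Z)) :=
    isFiniteMeasure_withDensity_ofReal (hint.div_const Z).2
  refine Measure.ext_of_charFun ?_
  ext t
  have hG := GaussianFourier.integral_cexp_neg_mul_sq_norm_add (V := EuclideanSpace ℝ ι)
    (b := ((1 / 2 : ℝ) : ℂ)) (by norm_num) Complex.I t
  have hZc : (Z : ℂ) = (Real.pi / ((1 / 2 : ℝ) : ℂ)) ^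
      (Module.finrank ℝ (EuclideanSpace ℝ ι) / 2 : ℂ) := by
    rw [← GaussianFourier.integral_cexp_neg_mul_sq_norm (V := EuclideanSpace ℝ ι)
      (b := ((1 / 2 : ℝ) : ℂ)) (by norm_num), hZ, ← integral_complex_ofReal]
    simp
  rw [charFun_stdGaussian, charFun_apply, integral_withDensity_eq_integral_toReal_smul
    (by fun_prop) (ae_of_all _ fun _ => ENNReal.ofReal_lt_top)]
  have hcongr : ∀ x : EuclideanSpace ℝ ι,
      (ENNReal.ofReal (Real.exp (-(1 / 2) * ‖x‖ ^ 2) / Z)).toReal •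
        Complex.exp (inner ℝ x t * Complex.I) =
      (Z : ℂ)⁻¹ * Complex.exp (-((1 / 2 : ℝ) : ℂ) * ‖x‖ ^ 2 + Complex.I * inner ℝ t x) := by
    intro x
    rw [ENNReal.toReal_ofReal (by positivity), Complex.exp_add, Complex.real_smul,
      real_inner_comm x t, mul_comm Complex.I]
    push_cast
    ring
  simp_rw [hcongr]
  rw [integral_const_mul, hG, ← hZc, inv_mul_cancel_left₀ (by exact_mod_cast hZ0.ne')]
  congr 1
  rw [Complex.I_sq]
  push_cast
  ring

theorem integral_stdGaussian (g : EuclideanSpace ℝ ι → ℝ) :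
    ∫ x, g x ∂stdGaussian (EuclideanSpace ℝ ι) =
      (∫ x, g x * Real.exp (-(1 / 2) * ‖x‖ ^ 2)) /
        ∫ y : EuclideanSpace ℝ ι, Real.exp (-(1 / 2) * ‖y‖ ^ 2) := by
  rw [stdGaussian_eq_withDensity, integral_withDensity_eq_integral_toReal_smul
    (by fun_prop) (ae_of_all _ fun _ => ENNReal.ofReal_lt_top), ← integral_div]
  refine integral_congr_ae (ae_of_all _ fun x => ?_)
  simp only [smul_eq_mul]
  rw [ENNReal.toReal_ofReal]
  · ring
  · exact div_nonneg (Real.exp_pos _).le (integral_nonneg fun _ => (Real.exp_pos _).le)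

variable [DecidableEq ι]

open scoped MatrixOrder in
/-- The centered Gaussian measure with precision matrix `S` has Lebesgue density proportional to
`exp (-⟨y, S y⟩ / 2)`. -/
theorem integral_multivariateGaussian_inv {S : Matrix ι ι ℝ} (hS : S.PosDef)
    {g : EuclideanSpace ℝ ι → ℝ} (hg : Continuous g) :
    ∫ x, g x ∂multivariateGaussian 0 S⁻¹ =
      (∫ y, g y * Real.exp (-(1 / 2) * (y.ofLp ⬝ᵥ S.mulVec y.ofLp))) /
        ∫ y : EuclideanSpace ℝ ι, Real.exp (-(1 / 2) * (y.ofLp ⬝ᵥ S.mulVec y.ofLp)) := by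
  have hSi : S⁻¹.PosDef := hS.inv
  set r : Matrix ι ι ℝ := CFC.sqrt S⁻¹ with hr
  have hrr : r * r = S⁻¹ := CFC.sqrt_mul_sqrt_self _ hSi.posSemidef.nonneg
  have hrT : r.transpose = r := by
    have : IsSelfAdjoint r := (CFC.sqrt_nonneg S⁻¹).isSelfAdjoint
    simpa [Matrix.star_eq_conjTranspose, Matrix.conjTranspose_eq_transpose_of_trivial] using
      this.star_eq
  have hdet : IsUnit S.det := hS.det_pos.ne'.isUnit
  have hrS : r * (r * S) = 1 := by rw [← mul_assoc, hrr, Matrix.nonsing_inv_mul _ hdet]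
  have hSr : r * S * r = 1 := mul_eq_one_comm.1 hrS
  set R := Matrix.toEuclideanCLM (n := ι) (𝕜 := ℝ) r with hR
  have hQ : ∀ x : EuclideanSpace ℝ ι, (R x).ofLp ⬝ᵥ S.mulVec (R x).ofLp = ‖x‖ ^ 2 := by
    intro x
    rw [hR, Matrix.ofLp_toEuclideanCLM, Matrix.mulVec_mulVec, Matrix.dotProduct_mulVec,
      Matrix.vecMul_mulVec, hrT, ← mul_assoc, hSr, Matrix.vecMul_one,
      EuclideanSpace.real_norm_sq_eq]
    simp [dotProduct, sq]
  have hRdet : LinearMap.det (R : EuclideanSpace ℝ ι →ₗ[ℝ] EuclideanSpace ℝ ι) ≠ 0 := by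
    intro h0
    have h1 : R * Matrix.toEuclideanCLM (n := ι) (𝕜 := ℝ) (r * S) = 1 := by
      rw [hR, ← map_mul, hrS, map_one]
    have h2 : (R : EuclideanSpace ℝ ι →ₗ[ℝ] EuclideanSpace ℝ ι) *
        (Matrix.toEuclideanCLM (n := ι) (𝕜 := ℝ) (r * S) :
          EuclideanSpace ℝ ι →ₗ[ℝ] EuclideanSpace ℝ ι) = 1 :=
      congrArg (fun T : EuclideanSpace ℝ ι →L[ℝ] EuclideanSpace ℝ ι =>
        (T : EuclideanSpace ℝ ι →ₗ[ℝ] EuclideanSpace ℝ ι)) h1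
    have h3 := congrArg LinearMap.det h2
    rw [map_mul, h0, zero_mul, map_one] at h3
    exact zero_ne_one h3
  set k := |(LinearMap.det (R : EuclideanSpace ℝ ι →ₗ[ℝ] EuclideanSpace ℝ ι))⁻¹| with hk
  have hmap : Measure.map R (volume : Measure (EuclideanSpace ℝ ι)) = ENNReal.ofReal k • volume :=
    Measure.map_linearMap_addHaar_eq_smul_addHaar volume hRdet
  have hcv : ∀ f : EuclideanSpace ℝ ι → ℝ, Continuous f → ∫ x, f (R x) = k * ∫ y, f y := by
    intro f hf
    rw [← integral_map (by fun_prop) (by fun_prop), hmap, integral_smul_measure,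
      ENNReal.toReal_ofReal (abs_nonneg _), smul_eq_mul]
  have hQc : Continuous fun y : EuclideanSpace ℝ ι =>
      Real.exp (-(1 / 2) * (y.ofLp ⬝ᵥ S.mulVec y.ofLp)) := by
    fun_prop
  have hgen : ∀ f : EuclideanSpace ℝ ι → ℝ, Continuous f →
      ∫ x, f (R x) * Real.exp (-(1 / 2) * ‖x‖ ^ 2) =
        k * ∫ y, f y * Real.exp (-(1 / 2) * (y.ofLp ⬝ᵥ S.mulVec y.ofLp)) := by
    intro f hf
    have := hcv (fun y => f y * _) (hf.mul hQc)
    simpa only [hQ] using this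
  have hk0 : k ≠ 0 := abs_ne_zero.2 (inv_ne_zero hRdet)
  have h1 := hgen (fun _ => 1) continuous_const
  simp only [one_mul] at h1
  rw [multivariateGaussian, integral_map (by fun_prop) (by fun_prop), integral_stdGaussian]
  simp only [zero_add]
  rw [hgen g hg, h1, mul_div_mul_left _ _ hk0]

end Gaussian

theorem le_exp_sub_sq_div {t B : ℝ} (ht : 0 ≤ t) (htB : t ≤ B) :
    t ≤ Real.exp ((t - 1) - (√B + 1)⁻¹ ^ 2 * (t - 1) ^ 2) := by
  set s := √t with hs
  have hst : s ^ 2 = t := Real.sq_sqrt ht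
  have hs0 : 0 ≤ s := Real.sqrt_nonneg t
  have hsB : s ≤ √B := Real.sqrt_le_sqrt htB
  have h1 : (√B + 1)⁻¹ ^ 2 * (t - 1) ^ 2 ≤ (s - 1) ^ 2 := by
    have h2 : (√B + 1)⁻¹ * (s + 1) ≤ 1 := by
      rw [inv_mul_le_iff₀ (by positivity)]
      linarith
    have h3 : ((√B + 1)⁻¹ * (s + 1)) ^ 2 ≤ 1 := pow_le_one₀ (by positivity) h2
    calc (√B + 1)⁻¹ ^ 2 * (t - 1) ^ 2 = (s - 1) ^ 2 * ((√B + 1)⁻¹ * (s + 1)) ^ 2 := by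
          rw [← hst]; ring
      _ ≤ (s - 1) ^ 2 * 1 := mul_le_mul_of_nonneg_left h3 (sq_nonneg _)
      _ = (s - 1) ^ 2 := mul_one _
  calc t = s ^ 2 := hst.symm
    _ ≤ Real.exp (s - 1) ^ 2 := by
        have := Real.add_one_le_exp (s - 1)
        exact pow_le_pow_left₀ hs0 (by linarith) 2
    _ = Real.exp (2 * (s - 1)) := by rw [← Real.exp_nat_mul]; norm_num
    _ ≤ _ := Real.exp_le_exp.2 (by nlinarith)

theorem tendsto_mul_log_one_add_sub (s : ℝ) :
    Tendsto (fun κ : ℝ => κ * (Real.log (1 + s * (√κ)⁻¹) - s * (√κ)⁻¹)) atTop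
      (𝓝 (-(1 / 2) * s ^ 2)) := by
  have hu : Tendsto (fun κ : ℝ => (√κ)⁻¹) atTop (𝓝 0) :=
    tendsto_inv_atTop_zero.comp Real.tendsto_sqrt_atTop
  have hsu : Tendsto (fun κ : ℝ => |s * (√κ)⁻¹|) atTop (𝓝 0) := by
    simpa using (hu.const_mul s).abs
  have hlim : Tendsto (fun κ : ℝ => s ^ 2 * |s * (√κ)⁻¹| / (1 - |s * (√κ)⁻¹|)) atTop (𝓝 0) := by
    have h := (hsu.const_mul (s ^ 2)).div (hsu.const_sub 1) (by norm_num)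
    rw [mul_zero, zero_div] at h
    exact h
  rw [tendsto_iff_norm_sub_tendsto_zero]
  refine squeeze_zero' (Eventually.of_forall fun _ => norm_nonneg _) ?_ hlim
  filter_upwards [hsu.eventually_lt_const zero_lt_one, eventually_gt_atTop 0] with κ hκ hκ0
  have hx := Real.abs_log_sub_add_sum_range_le (x := -(s * (√κ)⁻¹)) (by rwa [abs_neg]) 2
  have hu2 : κ * (√κ)⁻¹ ^ 2 = 1 := by
    rw [inv_pow, Real.sq_sqrt hκ0.le, mul_inv_cancel₀ hκ0.ne']
  have e1 : κ * (Real.log (1 + s * (√κ)⁻¹) - s * (√κ)⁻¹) - -(1 / 2) * s ^ 2 =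
      κ * ((∑ i ∈ Finset.range 2, (-(s * (√κ)⁻¹)) ^ (i + 1) / ((i : ℝ) + 1)) +
        Real.log (1 - -(s * (√κ)⁻¹))) := by
    simp only [Finset.sum_range_succ, Finset.sum_range_zero, sub_neg_eq_add]
    push_cast
    linear_combination (-(1 / 2) * s ^ 2) * hu2
  have e2 : s ^ 2 * |s * (√κ)⁻¹| / (1 - |s * (√κ)⁻¹|) =
      κ * (|-(s * (√κ)⁻¹)| ^ (2 + 1) / (1 - |-(s * (√κ)⁻¹)|)) := by
    rw [abs_neg, pow_succ |s * (√κ)⁻¹| 2, sq_abs]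
    linear_combination (-(s ^ 2 * |s * (√κ)⁻¹| / (1 - |s * (√κ)⁻¹|))) * hu2
  rw [e1, e2, Real.norm_eq_abs, abs_mul, abs_of_pos hκ0]
  exact mul_le_mul_of_nonneg_left hx hκ0.le

section Laplace

variable {N : ℕ}

/-- The quadratic form of minus the Hessian of the logarithmic energy. -/
noncomputable def wallQuad (a b : ℝ) (z v : EuclideanSpace ℝ (Fin N)) : ℝ :=
  ∑ m, wallExponent N a b m * (wallLin v m / wallForm z m) ^ 2

/-- The `p`-th power of the ratio of the exponentials of the logarithmic energy at `x` and `z`. -/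
noncomputable def wallRatio (a b p : ℝ) (z x : EuclideanSpace ℝ (Fin N)) : ℝ :=
  ∏ m, (wallForm x m / wallForm z m) ^ (p * wallExponent N a b m)

theorem wallQuad_smul (a b t : ℝ) (z v : EuclideanSpace ℝ (Fin N)) :
    wallQuad a b z (t • v) = t ^ 2 * wallQuad a b z v := by
  rw [wallQuad, wallQuad, Finset.mul_sum]
  refine Finset.sum_congr rfl fun m _ => ?_
  rw [wallLin_smul]
  ring

theorem wallForm_add_div {z : EuclideanSpace ℝ (Fin N)} (hz : ∀ m, 0 < wallForm z m)
    (v : EuclideanSpace ℝ (Fin N)) (m : JacobiWall N) :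
    wallForm (z + v) m / wallForm z m = 1 + wallLin v m / wallForm z m := by
  rw [wallForm_add, add_div, div_self (hz m).ne']

theorem wallRatio_nonneg {a b p : ℝ} {z x : EuclideanSpace ℝ (Fin N)}
    (hz : ∀ m, 0 < wallForm z m) (hx : x ∈ jacobiAlcove N) : 0 ≤ wallRatio a b p z x :=
  Finset.prod_nonneg fun m _ =>
    Real.rpow_nonneg (div_nonneg (mem_jacobiAlcove_iff.1 hx m) (hz m).le) _

theorem exists_wallRatio_le {a b : ℝ} (ha : 0 ≤ a) (hb : 0 < b) {z : EuclideanSpace ℝ (Fin N)}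
    (hz : ∀ m, 0 < wallForm z m)
    (hcrit : ∀ v, ∑ m, wallExponent N a b m * (wallLin v m / wallForm z m) = 0) :
    ∃ c : ℝ, 0 < c ∧ ∀ v, z + v ∈ jacobiAlcove N → ∀ p, 0 ≤ p →
      wallRatio a b p z (z + v) ≤ Real.exp (-(p * c) * wallQuad a b z v) := by
  set B : ℝ := ∑ m, 2 / wallForm z m with hB
  refine ⟨(√B + 1)⁻¹ ^ 2, by positivity, fun v hv p hp => ?_⟩
  set c := (√B + 1)⁻¹ ^ 2 with hc
  have hsum : -(p * c) * wallQuad a b z v =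
      ∑ m, (wallLin v m / wallForm z m - c * (wallLin v m / wallForm z m) ^ 2) *
        (p * wallExponent N a b m) := by
    have : ∑ m, (wallLin v m / wallForm z m - c * (wallLin v m / wallForm z m) ^ 2) *
        (p * wallExponent N a b m) =
        p * ∑ m, wallExponent N a b m * (wallLin v m / wallForm z m) -
          p * c * wallQuad a b z v := by
      rw [wallQuad, Finset.mul_sum, Finset.mul_sum, ← Finset.sum_sub_distrib]
      exact Finset.sum_congr rfl fun m _ => by ring
    rw [this, hcrit]
    ring
  rw [hsum, Real.exp_sum, wallRatio]
  refine Finset.prod_le_prod (fun m _ => Real.rpow_nonneg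
    (div_nonneg (mem_jacobiAlcove_iff.1 hv m) (hz m).le) _) fun m _ => ?_
  rw [Real.exp_mul]
  refine Real.rpow_le_rpow (div_nonneg (mem_jacobiAlcove_iff.1 hv m) (hz m).le) ?_
    (mul_nonneg hp (wallExponent_pos ha hb m).le)
  have ht := le_exp_sub_sq_div (t := wallForm (z + v) m / wallForm z m) (B := B)
    (div_nonneg (mem_jacobiAlcove_iff.1 hv m) (hz m).le) ?_
  · have h1 : wallForm (z + v) m / wallForm z m - 1 = wallLin v m / wallForm z m := by
      rw [wallForm_add_div hz]
      ring
    rwa [h1] at ht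
  · refine (div_le_div_of_nonneg_right (wallForm_le_two hv m) (hz m).le).trans ?_
    exact Finset.single_le_sum (f := fun m => 2 / wallForm z m)
      (fun m _ => div_nonneg zero_le_two (hz m).le) (Finset.mem_univ m)

theorem tendsto_wallRatio {a b : ℝ} {z : EuclideanSpace ℝ (Fin N)} (hz : ∀ m, 0 < wallForm z m)
    (hcrit : ∀ v, ∑ m, wallExponent N a b m * (wallLin v m / wallForm z m) = 0) (q : ℝ)
    (y : EuclideanSpace ℝ (Fin N)) :
    Tendsto (fun κ : ℝ => wallRatio a b (κ - q) z (z + (√κ)⁻¹ • y)) atTop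
      (𝓝 (Real.exp (-(1 / 2) * wallQuad a b z y))) := by
  have hu : Tendsto (fun κ : ℝ => (√κ)⁻¹) atTop (𝓝 0) :=
    tendsto_inv_atTop_zero.comp Real.tendsto_sqrt_atTop
  set s : JacobiWall N → ℝ := fun m => wallLin y m / wallForm z m with hs
  have hlim : Tendsto (fun κ : ℝ => (1 - q * κ⁻¹) * ∑ m, wallExponent N a b m *
      (κ * (Real.log (1 + s m * (√κ)⁻¹) - s m * (√κ)⁻¹))) atTop
      (𝓝 (-(1 / 2) * wallQuad a b z y)) := by
    have h1 : Tendsto (fun κ : ℝ => 1 - q * κ⁻¹) atTop (𝓝 1) := by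
      simpa using (tendsto_inv_atTop_zero.const_mul q).const_sub (1 : ℝ)
    have h2 := tendsto_finsetSum Finset.univ fun m (_ : m ∈ Finset.univ) =>
      (tendsto_mul_log_one_add_sub (s m)).const_mul (wallExponent N a b m)
    have h3 := h1.mul h2
    convert h3 using 2
    rw [wallQuad, one_mul, Finset.mul_sum]
    exact Finset.sum_congr rfl fun m _ => by simp only [hs]; ring
  refine ((Real.continuous_exp.tendsto _).comp hlim).congr' ?_
  have hpos : ∀ᶠ κ : ℝ in atTop, ∀ m, 0 < 1 + s m * (√κ)⁻¹ := by
    refine eventually_all.2 fun m => ?_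
    have : Tendsto (fun κ : ℝ => 1 + s m * (√κ)⁻¹) atTop (𝓝 1) := by
      simpa using (hu.const_mul (s m)).const_add 1
    exact this.eventually_const_lt zero_lt_one
  filter_upwards [hpos, eventually_gt_atTop 0] with κ hκ hκ0
  have hterm : ∀ m, wallForm (z + (√κ)⁻¹ • y) m / wallForm z m = 1 + s m * (√κ)⁻¹ := fun m => by
    rw [wallForm_add_div hz, wallLin_smul]
    simp only [hs]
    ring
  have hsum : (1 - q * κ⁻¹) * ∑ m, wallExponent N a b m *
      (κ * (Real.log (1 + s m * (√κ)⁻¹) - s m * (√κ)⁻¹)) =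
      ∑ m, Real.log (1 + s m * (√κ)⁻¹) * ((κ - q) * wallExponent N a b m) := by
    have h0 : ∑ m, wallExponent N a b m * s m = 0 := hcrit y
    have h1 : ∑ m, wallExponent N a b m *
        (κ * (Real.log (1 + s m * (√κ)⁻¹) - s m * (√κ)⁻¹)) =
        κ * ∑ m, wallExponent N a b m * Real.log (1 + s m * (√κ)⁻¹) -
          κ * (√κ)⁻¹ * ∑ m, wallExponent N a b m * s m := by
      simp only [Finset.mul_sum, ← Finset.sum_sub_distrib]
      exact Finset.sum_congr rfl fun m _ => by ring
    rw [h1, h0, mul_zero, sub_zero, ← mul_assoc, sub_mul, one_mul, mul_assoc q,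
      inv_mul_cancel₀ hκ0.ne', mul_one, Finset.mul_sum]
    exact Finset.sum_congr rfl fun m _ => by ring
  rw [Function.comp_apply, hsum, Real.exp_sum, wallRatio]
  refine Finset.prod_congr rfl fun m _ => ?_
  rw [hterm, Real.exp_mul, Real.exp_log (hκ m)]

end Laplace

section Rescaled

variable {N : ℕ}

theorem inv_mul_wallExponent_sub_nonneg {a b : ℝ} (ha : 0 ≤ a) (hb : 0 < b) (m : JacobiWall N) :
    0 ≤ b⁻¹ * wallExponent N a b m - wallShift N m := by
  have h : b⁻¹ * b = 1 := inv_mul_cancel₀ hb.ne'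
  have h' : 0 ≤ b⁻¹ * a := by positivity
  have h'' : 0 < b⁻¹ := inv_pos.2 hb
  rcases m with p | i | i <;> simp only [wallExponent, wallShift]
  · linarith
  · have : b⁻¹ * ((a + b) / 2) - 1 / 2 = b⁻¹ * a / 2 + (b⁻¹ * b - 1) / 2 := by ring
    rw [this, h]
    linarith
  · have : b⁻¹ * (b / 2) - 1 / 2 = (b⁻¹ * b - 1) / 2 := by ring
    rw [this, h]
    norm_num

theorem continuous_jacobiWeight_inv {a b : ℝ} (ha : 0 ≤ a) (hb : 0 < b) :
    Continuous (jacobiWeight N (b⁻¹ * a) (b⁻¹ * b) b⁻¹) := by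
  rw [show jacobiWeight N (b⁻¹ * a) (b⁻¹ * b) b⁻¹ = _ from
    funext (jacobiWeight_eq_prod_wall a b b⁻¹)]
  exact continuous_finsetProd _ fun m _ => (continuous_wallForm m).rpow_const fun _ =>
    Or.inr (inv_mul_wallExponent_sub_nonneg ha hb m)

theorem jacobiWeight_nonneg (a b κ : ℝ) {x : EuclideanSpace ℝ (Fin N)} (hx : x ∈ jacobiAlcove N) :
    0 ≤ jacobiWeight N (κ * a) (κ * b) κ x := by
  rw [jacobiWeight_eq_prod_wall]
  exact Finset.prod_nonneg fun m _ => Real.rpow_nonneg (mem_jacobiAlcove_iff.1 hx m) _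

theorem jacobiWeight_eq_wallRatio_mul {a b κ : ℝ} (ha : 0 ≤ a) (hb : 0 < b) (hκ : b⁻¹ ≤ κ)
    {z x : EuclideanSpace ℝ (Fin N)} (hz : ∀ m, 0 < wallForm z m) (hx : x ∈ jacobiAlcove N) :
    jacobiWeight N (κ * a) (κ * b) κ x =
      (∏ m, wallForm z m ^ ((κ - b⁻¹) * wallExponent N a b m)) *
        (wallRatio a b (κ - b⁻¹) z x * jacobiWeight N (b⁻¹ * a) (b⁻¹ * b) b⁻¹ x) := by
  rw [jacobiWeight_eq_prod_wall, jacobiWeight_eq_prod_wall, wallRatio, ← Finset.prod_mul_distrib,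
    ← Finset.prod_mul_distrib]
  refine Finset.prod_congr rfl fun m _ => ?_
  have hx0 := mem_jacobiAlcove_iff.1 hx m
  rw [Real.div_rpow hx0 (hz m).le, ← mul_assoc,
    mul_div_cancel₀ _ (Real.rpow_pos_of_pos (hz m) _).ne', ← Real.rpow_add_of_nonneg hx0
      (mul_nonneg (sub_nonneg.2 hκ) (wallExponent_pos ha hb m).le)
      (inv_mul_wallExponent_sub_nonneg ha hb m)]
  congr 1
  ring

/-- The density of the rescaled ensemble `√κ (X_κ - z)`, up to a factor that depends only on
`κ`. -/
noncomputable def rescaledDensity (a b : ℝ) (z : EuclideanSpace ℝ (Fin N)) (κ : ℝ)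
    (y : EuclideanSpace ℝ (Fin N)) : ℝ :=
  (jacobiAlcove N).indicator (fun x => wallRatio a b (κ - b⁻¹) z x *
    jacobiWeight N (b⁻¹ * a) (b⁻¹ * b) b⁻¹ x) (z + (√κ)⁻¹ • y)

theorem measurable_rescaledDensity (a b : ℝ) (z : EuclideanSpace ℝ (Fin N)) (κ : ℝ) :
    Measurable (rescaledDensity a b z κ) := by
  have h1 : Measurable (wallRatio a b (κ - b⁻¹) z) :=
    Finset.measurable_fun_prod _ fun m _ =>
      ((continuous_wallForm m).measurable.div_const _).pow_const _
  have h2 : Measurable (jacobiWeight N (b⁻¹ * a) (b⁻¹ * b) b⁻¹) := by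
    unfold jacobiWeight
    fun_prop
  exact ((h1.mul h2).indicator isClosed_jacobiAlcove.measurableSet).comp (by fun_prop)

theorem exists_rescaledDensity_le {a b : ℝ} (ha : 0 ≤ a) (hb : 0 < b)
    {z : EuclideanSpace ℝ (Fin N)} (hz : ∀ m, 0 < wallForm z m)
    (hcrit : ∀ v, ∑ m, wallExponent N a b m * (wallLin v m / wallForm z m) = 0) :
    ∃ c K : ℝ, 0 < c ∧ 0 ≤ K ∧ ∀ κ, 2 * b⁻¹ ≤ κ → ∀ y,
      ‖rescaledDensity a b z κ y‖ ≤ K * Real.exp (-c * ‖y‖ ^ 2) := by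
  obtain ⟨c, hc, hle⟩ := exists_wallRatio_le ha hb hz hcrit
  obtain ⟨K, hK⟩ := isCompact_jacobiAlcove.exists_bound_of_continuousOn
    (continuous_jacobiWeight_inv (N := N) ha hb).continuousOn
  have hK0 : 0 ≤ K := (norm_nonneg _).trans
    (hK z (mem_jacobiAlcove_iff.2 fun m => (hz m).le))
  refine ⟨c / 2 * (b / 8), K, by positivity, hK0, fun κ hκ y => ?_⟩
  have hb' : 0 < b⁻¹ := inv_pos.2 hb
  have hκ0 : 0 < κ := by linarith
  rw [rescaledDensity]
  by_cases hA : z + (√κ)⁻¹ • y ∈ jacobiAlcove N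
  · rw [Set.indicator_of_mem hA, norm_mul, mul_comm]
    refine mul_le_mul (hK _ hA) ?_ (norm_nonneg _) hK0
    rw [Real.norm_of_nonneg (wallRatio_nonneg hz hA)]
    refine (hle _ hA _ (by linarith)).trans (Real.exp_le_exp.2 ?_)
    rw [wallQuad_smul, inv_pow, Real.sq_sqrt hκ0.le]
    have hQ := sum_wallLin_sq_ge ha hb hz y
    have h1 : 1 / 2 ≤ (κ - b⁻¹) * κ⁻¹ := by
      rw [← div_eq_mul_inv, le_div_iff₀ hκ0]
      linarith
    have h2 : c / 2 * (b / 8 * ‖y‖ ^ 2) ≤ c * ((κ - b⁻¹) * κ⁻¹) * wallQuad a b z y :=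
      mul_le_mul (by nlinarith) hQ (by positivity) (by nlinarith)
    linarith
  · rw [Set.indicator_of_notMem hA, norm_zero]
    positivity

theorem tendsto_rescaledDensity {a b : ℝ} (ha : 0 ≤ a) (hb : 0 < b)
    {z : EuclideanSpace ℝ (Fin N)} (hz : ∀ m, 0 < wallForm z m)
    (hcrit : ∀ v, ∑ m, wallExponent N a b m * (wallLin v m / wallForm z m) = 0)
    (y : EuclideanSpace ℝ (Fin N)) :
    Tendsto (fun κ => rescaledDensity a b z κ y) atTop
      (𝓝 (Real.exp (-(1 / 2) * wallQuad a b z y) *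
        jacobiWeight N (b⁻¹ * a) (b⁻¹ * b) b⁻¹ z)) := by
  have hx : Tendsto (fun κ : ℝ => z + (√κ)⁻¹ • y) atTop (𝓝 z) := by
    have hu : Tendsto (fun κ : ℝ => (√κ)⁻¹) atTop (𝓝 0) :=
      tendsto_inv_atTop_zero.comp Real.tendsto_sqrt_atTop
    simpa using (hu.smul_const y).const_add z
  refine ((tendsto_wallRatio hz hcrit b⁻¹ y).mul
    (((continuous_jacobiWeight_inv ha hb).tendsto z).comp hx)).congr' ?_
  have hev : ∀ᶠ κ : ℝ in atTop, ∀ m, 0 < wallForm (z + (√κ)⁻¹ • y) m := eventually_all.2 fun m =>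
    (((continuous_wallForm m).tendsto z).comp hx).eventually_const_lt (hz m)
  filter_upwards [hev] with κ hκ
  rw [rescaledDensity, Set.indicator_of_mem (mem_jacobiAlcove_iff.2 fun m => (hκ m).le)]
  rfl

theorem tendsto_integral_rescaledDensity {a b : ℝ} (ha : 0 ≤ a) (hb : 0 < b)
    {z : EuclideanSpace ℝ (Fin N)} (hz : ∀ m, 0 < wallForm z m)
    (hcrit : ∀ v, ∑ m, wallExponent N a b m * (wallLin v m / wallForm z m) = 0)
    {g : EuclideanSpace ℝ (Fin N) → ℝ} (hg : Continuous g) {M : ℝ} (hM : ∀ y, ‖g y‖ ≤ M) :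
    Tendsto (fun κ => ∫ y, g y * rescaledDensity a b z κ y) atTop
      (𝓝 ((∫ y, g y * Real.exp (-(1 / 2) * wallQuad a b z y)) *
        jacobiWeight N (b⁻¹ * a) (b⁻¹ * b) b⁻¹ z)) := by
  obtain ⟨c, K, hc, hK, hle⟩ := exists_rescaledDensity_le ha hb hz hcrit
  have hM0 : 0 ≤ M := (norm_nonneg _).trans (hM 0)
  rw [← integral_mul_const]
  refine tendsto_integral_filter_of_dominated_convergence
    (fun y => M * (K * Real.exp (-c * ‖y‖ ^ 2))) ?_ ?_ ?_ ?_
  · exact Eventually.of_forall fun κ =>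
      (hg.measurable.mul (measurable_rescaledDensity a b z κ)).aestronglyMeasurable
  · filter_upwards [eventually_ge_atTop (2 * b⁻¹)] with κ hκ
    refine ae_of_all _ fun y => ?_
    rw [norm_mul]
    exact mul_le_mul (hM y) (hle κ hκ y) (norm_nonneg _) hM0
  · exact ((integrable_exp_neg_mul_norm_sq hc).const_mul K).const_mul M
  · refine ae_of_all _ fun y => ?_
    rw [mul_assoc]
    exact (tendsto_rescaledDensity ha hb hz hcrit y).const_mul (g y)

theorem integral_jacobiEnsemble_rescaled {a b κ : ℝ} (ha : 0 ≤ a) (hb : 0 < b) (hκ : b⁻¹ ≤ κ)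
    {z : EuclideanSpace ℝ (Fin N)} (hz : ∀ m, 0 < wallForm z m)
    (g : EuclideanSpace ℝ (Fin N) → ℝ) :
    ∫ x, g (√κ • (x - z)) ∂jacobiEnsemble N (κ * a) (κ * b) κ =
      (∫ y, g y * rescaledDensity a b z κ y) / ∫ y, rescaledDensity a b z κ y := by
  have hκ0 : 0 < κ := (inv_pos.2 hb).trans_le hκ
  have hsq : √κ ≠ 0 := (Real.sqrt_pos.2 hκ0).ne'
  have hprob := isProbabilityMeasure_jacobiEnsemble N (mul_nonneg hκ0.le ha)
    (mul_nonneg hκ0.le hb.le) hκ0.le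
  obtain ⟨k, hk⟩ : ∃ k : ℝ, ∀ f : EuclideanSpace ℝ (Fin N) → ℝ,
      ∫ x, f (√κ • (x - z)) ∂jacobiEnsemble N (κ * a) (κ * b) κ =
        k * ∫ y, f y * rescaledDensity a b z κ y := by
    set r := ((jacobiUnnormalized N (κ * a) (κ * b) κ Set.univ)⁻¹).toReal with hr
    set D := ∏ m, wallForm z m ^ ((κ - b⁻¹) * wallExponent N a b m) with hD
    set k := |((√κ)⁻¹ ^ Module.finrank ℝ (EuclideanSpace ℝ (Fin N)))⁻¹| with hk
    have hk0 : k ≠ 0 := abs_ne_zero.2 (inv_ne_zero (pow_ne_zero _ (inv_ne_zero hsq)))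
    refine ⟨r * (D * k⁻¹), fun f => ?_⟩
    have hwm : Measurable (jacobiWeight N (κ * a) (κ * b) κ) := by
      unfold jacobiWeight
      fun_prop
    set G : EuclideanSpace ℝ (Fin N) → ℝ := fun x => f (√κ • (x - z)) *
      (jacobiAlcove N).indicator (fun x => wallRatio a b (κ - b⁻¹) z x *
        jacobiWeight N (b⁻¹ * a) (b⁻¹ * b) b⁻¹ x) x with hG
    have hcv : ∫ y, f y * rescaledDensity a b z κ y = k * ∫ x, G x := by
      have h1 := Measure.integral_comp_smul (volume : Measure (EuclideanSpace ℝ (Fin N)))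
        (fun x => G (z + x)) (√κ)⁻¹
      rw [integral_add_left_eq_self G z, smul_eq_mul, ← hk] at h1
      rw [← h1]
      refine integral_congr_ae (ae_of_all _ fun y => ?_)
      simp only [hG, rescaledDensity, add_sub_cancel_left, smul_inv_smul₀ hsq]
    rw [jacobiEnsemble, integral_smul_measure, ← hr, smul_eq_mul, jacobiUnnormalized,
      integral_withDensity_eq_integral_toReal_smul (by fun_prop)
        (ae_of_all _ fun _ => ENNReal.ofReal_lt_top), hcv, mul_assoc, mul_assoc,
      inv_mul_cancel_left₀ hk0, ← integral_const_mul D,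
      ← integral_indicator isClosed_jacobiAlcove.measurableSet]
    congr 1
    refine integral_congr_ae (ae_of_all _ fun x => ?_)
    by_cases hA : x ∈ jacobiAlcove N
    · simp only [hG, Set.indicator_of_mem hA]
      rw [ENNReal.toReal_ofReal (jacobiWeight_nonneg a b κ hA), smul_eq_mul,
        jacobiWeight_eq_wallRatio_mul ha hb hκ hz hA]
      ring
    · simp only [hG, Set.indicator_of_notMem hA, mul_zero]
  have h1 := hk fun _ => 1
  simp only [one_mul, integral_const, probReal_univ, smul_eq_mul, mul_one] at h1
  have hF : ∫ y, rescaledDensity a b z κ y ≠ 0 := right_ne_zero_of_mul (h1 ▸ one_ne_zero)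
  rw [hk g, eq_div_iff hF]
  linear_combination (-(∫ y, g y * rescaledDensity a b z κ y)) * h1

end Rescaled

theorem isHermitian_jacobiInvCov (N : ℕ) (a b : ℝ) (z : EuclideanSpace ℝ (Fin N)) :
    (jacobiInvCov N a b z).IsHermitian := by
  ext i j
  rw [Matrix.conjTranspose_apply, star_trivial]
  simp only [jacobiInvCov, Matrix.of_apply]
  by_cases h : i = j
  · subst h
    rfl
  · rw [if_neg h, if_neg (Ne.symm h), ← neg_sub (z i), neg_sq]

theorem posDef_jacobiInvCov {N : ℕ} {a b : ℝ} (ha : 0 ≤ a) (hb : 0 < b)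
    {z : EuclideanSpace ℝ (Fin N)} (hz : ∀ m, 0 < wallForm z m) :
    (jacobiInvCov N a b z).PosDef := by
  refine Matrix.PosDef.of_dotProduct_mulVec_pos (isHermitian_jacobiInvCov N a b z) fun v hv => ?_
  rw [star_trivial]
  have h := sum_wallLin_sq_ge ha hb hz (WithLp.toLp 2 v)
  rw [sum_wallLin_sq] at h
  refine lt_of_lt_of_le ?_ h
  have : WithLp.toLp 2 v ≠ 0 := fun h0 => hv (by simpa using congrArg WithLp.ofLp h0)
  have := norm_pos_iff.2 this
  positivity

theorem theorem2p5 (N : ℕ) (a b : ℝ) (ha : 0 ≤ a) (hb : 0 < b)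
    {Ω : Set.Ioi (0 : ℝ) → Type*} [∀ κ, MeasurableSpace (Ω κ)]
    (P : ∀ κ, Measure (Ω κ)) [∀ κ, IsProbabilityMeasure (P κ)]
    (X : ∀ κ, Ω κ → EuclideanSpace ℝ (Fin N))
    (hX : ∀ κ : Set.Ioi (0 : ℝ), HasLaw (X κ) (jacobiEnsemble N (κ * a) (κ * b) κ) (P κ))
    (z : EuclideanSpace ℝ (Fin N)) (hz : z = jacobiZeros N (a + b - 1) (b - 1)) :
    (StrictMono (fun i => z i) ∧
      ∀ i, -1 < z i ∧ z i < 1 ∧ (jacobiPolynomial N (a + b - 1) (b - 1)).IsRoot (z i)) ∧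
    ∃ Sigma : Matrix (Fin N) (Fin N) ℝ, Sigma.PosDef ∧ Sigma⁻¹ = jacobiInvCov N a b z ∧
      TendstoInDistribution (fun (κ : Set.Ioi (0 : ℝ)) ω => Real.sqrt κ • (X κ ω - z)) atTop
        (id : EuclideanSpace ℝ (Fin N) → EuclideanSpace ℝ (Fin N))
        P (multivariateGaussian 0 Sigma) := by
  obtain ⟨hpos, hcrit, hroot⟩ := jacobiZeros_spec N ha hb
  rw [← hz] at hpos hcrit hroot
  obtain ⟨hmono, hmem⟩ := wallForm_pos_iff.1 hpos
  have hS := posDef_jacobiInvCov ha hb hpos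
  refine ⟨⟨hmono, fun i => ⟨(hmem i).1, (hmem i).2, hroot i⟩⟩, (jacobiInvCov N a b z)⁻¹, hS.inv,
    Matrix.nonsing_inv_nonsing_inv _ hS.det_pos.ne'.isUnit, ?_⟩
  have haem : ∀ κ : Set.Ioi (0 : ℝ),
      AEMeasurable (fun ω => Real.sqrt κ • (X κ ω - z)) (P κ) := fun κ =>
    ((hX κ).aemeasurable.sub_const z).const_smul √(κ : ℝ)
  refine ⟨haem, by fun_prop, ?_⟩
  refine ProbabilityMeasure.tendsto_iff_forall_integral_tendsto.2 fun g => ?_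
  have hH : 0 < jacobiWeight N (b⁻¹ * a) (b⁻¹ * b) b⁻¹ z := by
    rw [jacobiWeight_eq_prod_wall]
    exact Finset.prod_pos fun m _ => Real.rpow_pos_of_pos (hpos m) _
  have hQ : ∀ y : EuclideanSpace ℝ (Fin N),
      wallQuad a b z y = y.ofLp ⬝ᵥ (jacobiInvCov N a b z).mulVec y.ofLp :=
    fun y => sum_wallLin_sq a b z y
  have hQint : Integrable fun y : EuclideanSpace ℝ (Fin N) =>
      Real.exp (-(1 / 2) * wallQuad a b z y) := by
    refine (integrable_exp_neg_mul_norm_sq (c := 1 / 2 * (b / 8)) (by positivity)).mono' ?_ ?_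
    · simp only [hQ]
      exact Continuous.aestronglyMeasurable (by fun_prop)
    · refine ae_of_all _ fun y => ?_
      rw [Real.norm_of_nonneg (Real.exp_pos _).le]
      refine Real.exp_le_exp.2 ?_
      have : b / 8 * ‖y‖ ^ 2 ≤ wallQuad a b z y := sum_wallLin_sq_ge ha hb hpos y
      linarith
  have hlim : Tendsto (fun κ : ℝ => (∫ y, g y * rescaledDensity a b z κ y) /
      ∫ y, rescaledDensity a b z κ y) atTop
      (𝓝 (∫ y, g y ∂multivariateGaussian 0 (jacobiInvCov N a b z)⁻¹)) := by
    have h1 := tendsto_integral_rescaledDensity ha hb hpos hcrit g.continuous g.norm_coe_le_norm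
    have h2 := tendsto_integral_rescaledDensity ha hb hpos hcrit (g := fun _ => 1)
      continuous_const (M := 1) (by simp)
    simp only [one_mul] at h2
    have h3 := h1.div h2 (mul_pos (MeasureTheory.integral_exp_pos hQint) hH).ne'
    rw [mul_div_mul_right _ _ hH.ne'] at h3
    rw [integral_multivariateGaussian_inv hS g.continuous]
    simp only [hQ] at h3
    exact h3
  have hval : Tendsto (fun κ : Set.Ioi (0 : ℝ) => (κ : ℝ)) atTop atTop :=
    tendsto_comp_val_Ioi_atTop.2 tendsto_id
  change Tendsto
    (fun κ : Set.Ioi (0 : ℝ) => ∫ y, g y ∂Measure.map (fun ω => √(κ : ℝ) • (X κ ω - z)) (P κ)) atTop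
    (𝓝 (∫ y, g y ∂Measure.map id (multivariateGaussian 0 (jacobiInvCov N a b z)⁻¹)))
  rw [Measure.map_id]
  refine (hlim.comp hval).congr' ?_
  filter_upwards [eventually_ge_atTop (⟨b⁻¹, inv_pos.2 hb⟩ : Set.Ioi (0 : ℝ))] with κ hκ
  rw [Function.comp_apply, ← integral_jacobiEnsemble_rescaled ha hb hκ hpos,
    integral_map (haem κ) g.continuous.aestronglyMeasurable, ← (hX κ).map_eq,
    integral_map (hX κ).aemeasurable]
  exact Continuous.aestronglyMeasurable (by fun_prop)
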